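/- For $k\in\mathbb{C}$ let $\mathrm{sn}(z)=\mathrm{sn}(z,k)$ be the Jacobi sine amplitude, i.e. the inverse near $0$ of $w\mapsto\int_0^w \frac{dt}{\sqrt{(1-t^2)(1-k^2t^2)}}$, and put $$\mathrm{ns}^2=\frac1{\mathrm{sn}^2},\qquad \mathrm{nc}^2=\frac1{1-\mathrm{sn}^2},\qquad \mathrm{dn}^2=1-k^2\,\mathrm{sn}^2,\qquad \mathrm{nd}^2=\frac1{1-k^2\,\mathrm{sn}^2}.$$ Define $c_j(k),d_j(k),e_j(k),f_j(k)$ for $j\ge1$ by the expansions at $z=0$ $$\mathrm{ns}^2(z)-\frac1{z^2}-\frac{1+k^2}{3}=\sum_{j\ge1}c_j(k)z^{2j},\qquad (1-k^2)(\mathrm{nd}^2(z)-1)=\sum_{j\ge1}d_j(k)z^{2j},$$ $$(1-k^2)(\mathrm{nc}^2(z)-1)=\sum_{j\ge1}e_j(k)z^{2j},\qquad \mathrm{dn}^2(z)-1=\sum_{j\ge1}f_j(k)z^{2j},$$ and let $\Theta_j^{\pm}=c_j\pm d_j$ and $\Lambda_j^{\pm}=e_j\pm f_j$. (1) For every $j\ge1$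 the functions $\Theta_j^\pm,\Lambda_j^\pm$ are polynomials in $k^2$ with rational coefficients, and the $\mathbb{Q}$-vector space $$S_j=\{t\in\mathbb{Q}^4:\ -t_1\Theta_j^-+t_2\Theta_j^+-t_3\Lambda_j^-+t_4\Lambda_j^+=0 \text{ identically in } k\}$$ is one-dimensional, spanned by $(1-2^{2j+1},\,2^{2j+1},\,1,\,0)$. (2) Let $k\in\mathbb{C}\setminus\{0,\pm1\}$, let $K=\int_0^1\frac{dt}{\sqrt{(1-t^2)(1-k^2t^2)}}$, and for $j\ge2$ let $$(x_{4j-3},x_{4j-2},x_{4j-1},x_{4j})=\Big(\frac{2K}{\pi}\Big)^{2j}\cdot\begin{cases}(\Theta_{j-1}^-(k),\Theta_{j-1}^+(k),\Lambda_{j-1}^-(k),\Lambda_{j-1}^+(k)), & j\text{ even},\\ (\Theta_{j-1}^+(k),\Theta_{j-1}^-(k),\Lambda_{j-1}^+(k),\Lambda_{j-1}^-(k)), & j\text{ odd}.\end{cases}$$ Then $x_{4j-3},x_{4j-2},x_{4j-1}$ are linearly dependent over $\mathbb{Q}$ for every even $j\ge2$, and $x_{4j-3},x_{4j-2},x_{4j}$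 are linearly dependent over $\mathbb{Q}$ for every odd $j\ge3$. -/

import Mathlib

namespace JacobiAux

open scoped Topology

noncomputable section

/-- The elliptic integral `∫₀ʷ dt / √((1 - t²)(1 - k²t²))` along the straight segment from `0` to
`w`, with the principal branch of the square root (the integrand is holomorphic for `t` near `0`,
with value `1` at `t = 0`). -/
def ellipticF (k w : ℂ) : ℂ :=
  ∫ s in (0 : ℝ)..1, w * (1 / ((1 - (s * w) ^ 2) * (1 - k ^ 2 * (s * w) ^ 2)) ^ (1 / 2 : ℂ))

theorem ellipticF_aux (k : ℂ) :
    AnalyticAt ℂ (ellipticF k) 0 ∧ HasDerivAt (ellipticF k) 1 0 := by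
  set p : ℂ → ℂ := fun t => (1 - t ^ 2) * (1 - k ^ 2 * t ^ 2) with hp
  set g : ℂ → ℂ := fun t => 1 / (p t) ^ (1 / 2 : ℂ) with hg
  have hpc : Continuous p := by fun_prop
  have hp0 : p 0 = 1 := by simp [hp]
  have hev : ∀ᶠ t in 𝓝 (0 : ℂ), p t ∈ Complex.slitPlane := by
    apply hpc.continuousAt.eventually
    rw [hp0]
    exact Complex.isOpen_slitPlane.mem_nhds Complex.one_mem_slitPlane
  obtain ⟨r, hr, hball⟩ := Metric.eventually_nhds_iff_ball.1 hev
  have hgd : DifferentiableOn ℂ g (Metric.ball 0 r) := by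
    intro t ht
    have h1 : DifferentiableAt ℂ (fun t => p t ^ (1 / 2 : ℂ)) t :=
      DifferentiableAt.cpow_const (by fun_prop) (hball t ht)
    have h2 : p t ^ (1 / 2 : ℂ) ≠ 0 := by
      rw [Complex.cpow_def_of_ne_zero (Complex.slitPlane_ne_zero (hball t ht))]
      exact Complex.exp_ne_zero _
    exact ((differentiableAt_const (1 : ℂ)).div h1 h2).differentiableWithinAt
  obtain ⟨G, hG⟩ := hgd.isExactOn_ball
  have hF : ∀ w ∈ Metric.ball (0 : ℂ) r, ellipticF k w = G w - G 0 := by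
    intro w hw
    have hsw : ∀ s ∈ Set.uIcc (0 : ℝ) 1, (s : ℂ) * w ∈ Metric.ball (0 : ℂ) r := by
      intro s hs
      rw [Set.uIcc_of_le zero_le_one] at hs
      rw [mem_ball_zero_iff] at hw ⊢
      rw [norm_mul, Complex.norm_real, Real.norm_of_nonneg hs.1]
      exact lt_of_le_of_lt (mul_le_of_le_one_left (norm_nonneg _) hs.2) hw
    have hd : ∀ s ∈ Set.uIcc (0 : ℝ) 1,
        HasDerivAt (fun s : ℝ => G ((s : ℂ) * w)) (w * g ((s : ℂ) * w)) s := by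
      intro s hs
      have h1 : HasDerivAt (fun s : ℝ => (s : ℂ) * w) w s := by
        simpa using (Complex.ofRealCLM.hasDerivAt (x := s)).mul_const w
      have h2 := (hG _ (hsw s hs)).comp s h1
      simpa [mul_comm, Function.comp_def] using h2
    have hc : ContinuousOn (fun s : ℝ => w * g ((s : ℂ) * w)) (Set.uIcc (0 : ℝ) 1) := by
      refine continuousOn_const.mul (hgd.continuousOn.comp (by fun_prop) ?_)
      exact fun s hs => hsw s hs
    have := intervalIntegral.integral_eq_sub_of_hasDerivAt hd hc.intervalIntegrable
    simpa [ellipticF, hg, hp] using this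
  have hGa : AnalyticAt ℂ G 0 := by
    apply DifferentiableOn.analyticAt (s := Metric.ball 0 r)
    · exact fun t ht => (hG t ht).differentiableAt.differentiableWithinAt
    · exact Metric.ball_mem_nhds 0 hr
  have hEq : (fun w => G w - G 0) =ᶠ[𝓝 0] ellipticF k := by
    filter_upwards [Metric.ball_mem_nhds (0 : ℂ) hr] with w hw using (hF w hw).symm
  refine ⟨(hGa.sub analyticAt_const).congr hEq, ?_⟩
  have hd0 : HasDerivAt (fun w => G w - G 0) (g 0) 0 :=
    (hG 0 (Metric.mem_ball_self hr)).sub_const (G 0)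
  have hg0 : g 0 = 1 := by simp [hg, hp0]
  rw [hg0] at hd0
  exact hd0.congr_of_eventuallyEq hEq.symm

theorem analyticAt_ellipticF (k : ℂ) : AnalyticAt ℂ (ellipticF k) 0 :=
  (ellipticF_aux k).1

theorem deriv_ellipticF_ne_zero (k : ℂ) : deriv (ellipticF k) 0 ≠ 0 := by
  rw [(ellipticF_aux k).2.deriv]
  exact one_ne_zero

/-- The Jacobi sine amplitude `sn(·, k)` near `z = 0`: the local inverse at `0` of the elliptic
integral `ellipticF k`. Only its germ at `0` is meaningful, and only this germ is used below. -/
def sn (k : ℂ) : ℂ → ℂ :=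
  (analyticAt_ellipticF k).hasStrictDerivAt.localInverse _ _ _ (deriv_ellipticF_ne_zero k)

def nsSq (k z : ℂ) : ℂ := 1 / sn k z ^ 2

def ncSq (k z : ℂ) : ℂ := 1 / (1 - sn k z ^ 2)

def dnSq (k z : ℂ) : ℂ := 1 - k ^ 2 * sn k z ^ 2

def ndSq (k z : ℂ) : ℂ := 1 / (1 - k ^ 2 * sn k z ^ 2)

/-- The `n`-th Taylor coefficient of `g` at `0`. -/
def taylorCoeff (g : ℂ → ℂ) (n : ℕ) : ℂ := iteratedDeriv n g 0 / (n.factorial : ℂ)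

/-- `c_j(k)`: the coefficient of `z^(2j)` in `ns²(z) - 1/z² - (1 + k²)/3 = ∑_{j ≥ 1} c_j(k) z^(2j)`.
The left-hand side has a removable singularity at `z = 0`, where its value is `0`. -/
def c (j : ℕ) (k : ℂ) : ℂ :=
  taylorCoeff (Function.update (fun z => nsSq k z - 1 / z ^ 2 - (1 + k ^ 2) / 3) 0 0) (2 * j)

/-- `d_j(k)`: the coefficient of `z^(2j)` in `(1 - k²)(nd²(z) - 1)`. -/
def d (j : ℕ) (k : ℂ) : ℂ := taylorCoeff (fun z => (1 - k ^ 2) * (ndSq k z - 1)) (2 * j)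

/-- `e_j(k)`: the coefficient of `z^(2j)` in `(1 - k²)(nc²(z) - 1)`. -/
def e (j : ℕ) (k : ℂ) : ℂ := taylorCoeff (fun z => (1 - k ^ 2) * (ncSq k z - 1)) (2 * j)

/-- `f_j(k)`: the coefficient of `z^(2j)` in `dn²(z) - 1`. -/
def f (j : ℕ) (k : ℂ) : ℂ := taylorCoeff (fun z => dnSq k z - 1) (2 * j)

def thetaMinus (j : ℕ) (k : ℂ) : ℂ := c j k - d j k

def thetaPlus (j : ℕ) (k : ℂ) : ℂ := c j k + d j k

def lambdaMinus (j : ℕ) (k : ℂ) : ℂ := e j k - f j k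

def lambdaPlus (j : ℕ) (k : ℂ) : ℂ := e j k + f j k

/-- The vector `(-Θ_j⁻, Θ_j⁺, -Λ_j⁻, Λ_j⁺)` of functions of the modulus. -/
def auxVec (j : ℕ) : Fin 4 → ℂ → ℂ :=
  ![fun k => -thetaMinus j k, thetaPlus j, fun k => -lambdaMinus j k, lambdaPlus j]

/-- The rational vectors `t` with `⟨t, (-Θ_j⁻, Θ_j⁺, -Λ_j⁻, Λ_j⁺)⟩ = 0`, identically in `k`. -/
def S (j : ℕ) : Submodule ℚ (Fin 4 → ℚ) where
  carrier := {t | ∑ i, t i • auxVec j i = 0}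
  add_mem' := by
    intro a b ha hb
    simp only [Set.mem_ofPred_eq, Pi.add_apply, add_smul, Finset.sum_add_distrib] at *
    rw [ha, hb, add_zero]
  zero_mem' := by simp
  smul_mem' := by
    intro r a ha
    simp only [Set.mem_ofPred_eq, Pi.smul_apply, smul_eq_mul, mul_smul] at *
    rw [← Finset.smul_sum, ha, smul_zero]

/-- The vector `(1 - 2^(2j+1), 2^(2j+1), 1, 0)`. -/
def v (j : ℕ) : Fin 4 → ℚ := ![1 - 2 ^ (2 * j + 1), 2 ^ (2 * j + 1), 1, 0]

/-- The complete elliptic integral of the first kind. -/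
def K (k : ℂ) : ℂ :=
  ∫ t in (0 : ℝ)..1, 1 / ((1 - (t : ℂ) ^ 2) * (1 - k ^ 2 * (t : ℂ) ^ 2)) ^ (1 / 2 : ℂ)

/-- The complete elliptic integral of the second kind. -/
def E (k : ℂ) : ℂ :=
  ∫ t in (0 : ℝ)..1, ((1 - k ^ 2 * (t : ℂ) ^ 2) / (1 - (t : ℂ) ^ 2)) ^ (1 / 2 : ℂ)

/-- The block `(x_{4j-3}, x_{4j-2}, x_{4j-1}, x_{4j})` for `j ≥ 1`. -/
def xBlock (k : ℂ) (j : ℕ) : Fin 4 → ℂ :=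
  if j = 1 then
    ![1, (2 * K k / Real.pi) ^ 2, (2 * K k / Real.pi) ^ 2 * (2 * k ^ 2 - 1),
      (2 * K k / Real.pi) ^ 2 * (6 * E k / K k - 5 + 4 * k ^ 2)]
  else if Even j then
    fun i => (2 * K k / Real.pi) ^ (2 * j) *
      ![thetaMinus (j - 1) k, thetaPlus (j - 1) k, lambdaMinus (j - 1) k, lambdaPlus (j - 1) k] i
  else
    fun i => (2 * K k / Real.pi) ^ (2 * j) *
      ![thetaPlus (j - 1) k, thetaMinus (j - 1) k, lambdaPlus (j - 1) k, lambdaMinus (j - 1) k] i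

/-- The quantity `x_n`, `n ≥ 1`: the entry of index `(n - 1) mod 4` of block `⌊(n - 1)/4⌋ + 1`. -/
def x (k : ℂ) (n : ℕ) : ℂ := xBlock k ((n - 1) / 4 + 1) (Fin.ofNat 4 (n - 1))

end

end JacobiAux

/-! Put y = sn² and m = k². The duplication formula for sn², inverted and split into partial
fractions in y, reads 4 ns²(2z) = ns² + (1 + m) + (1 - m)(nc² - 1) - (dn² - 1) - (1 - m)(nd² - 1).
Comparing coefficients of z^(2j) gives (2^(2j+2) - 1) c_j + d_j - e_j + f_j = 0 (`coeff_relation`),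
which is the stated relation written in Θ and Λ. Both dependence claims in part (2) are this
relation multiplied by a power of 2K/π.

There is no further relation because d_j, e_j, f_j are independent over ℚ
(`eq_zero_of_combination_eq_zero`). At k = 0 only e_j survives, as a coefficient of tan². At k = 1
only f_j survives, as a coefficient of -tanh². Finally, d_j / (k²(1 - k²)) at k = 0 is a nonzero
coefficient of sin².

Beyond the germ of sn, the work is formal: the Taylor series of sn² satisfies y'² = 4y(1 - y)(1 -
my), hence a quadratic second-order equation. That equation yields the coefficient recursion,
polynomiality in m, and the duplication formula through uniqueness of formal solutions. -/

namespace JacobiAux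

open scoped Topology PowerSeries
open PowerSeries

/-! ### Taylor expansion at 0 as a map from analytic germs to formal power series. -/

/-- The Taylor series of `g` at `0` as a formal power series. -/
noncomputable def taylorSeries (g : ℂ → ℂ) : ℂ⟦X⟧ := PowerSeries.mk (taylorCoeff g)

@[simp] theorem coeff_taylorSeries (g : ℂ → ℂ) (n : ℕ) :
    coeff n (taylorSeries g) = taylorCoeff g n := coeff_mk _ _

theorem taylorSeries_congr {g h : ℂ → ℂ} (hgh : g =ᶠ[𝓝 0] h) :
    taylorSeries g = taylorSeries h := by
  ext n
  simp [taylorCoeff, hgh.iteratedDeriv_eq n]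

theorem coeff_zero_taylorSeries (g : ℂ → ℂ) : coeff 0 (taylorSeries g) = g 0 := by
  rw [coeff_taylorSeries]
  simp [taylorCoeff]

theorem coeff_one_taylorSeries (g : ℂ → ℂ) : coeff 1 (taylorSeries g) = deriv g 0 := by
  rw [coeff_taylorSeries]
  simp [taylorCoeff]

theorem taylorSeries_add {g h : ℂ → ℂ} (hg : AnalyticAt ℂ g 0) (hh : AnalyticAt ℂ h 0) :
    taylorSeries (fun z => g z + h z) = taylorSeries g + taylorSeries h := by
  ext n
  simp [taylorCoeff, iteratedDeriv_fun_add hg.contDiffAt hh.contDiffAt, add_div]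

theorem taylorSeries_sub {g h : ℂ → ℂ} (hg : AnalyticAt ℂ g 0) (hh : AnalyticAt ℂ h 0) :
    taylorSeries (fun z => g z - h z) = taylorSeries g - taylorSeries h := by
  ext n
  simp [taylorCoeff, iteratedDeriv_fun_sub hg.contDiffAt hh.contDiffAt, sub_div]

theorem taylorSeries_mul {g h : ℂ → ℂ} (hg : AnalyticAt ℂ g 0) (hh : AnalyticAt ℂ h 0) :
    taylorSeries (fun z => g z * h z) = taylorSeries g * taylorSeries h := by
  ext n
  rw [coeff_mul, coeff_taylorSeries, taylorCoeff,
    iteratedDeriv_fun_mul hg.contDiffAt hh.contDiffAt, Finset.sum_div,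
    Finset.Nat.sum_antidiagonal_eq_sum_range_succ
      (fun i j => coeff i (taylorSeries g) * coeff j (taylorSeries h))]
  refine Finset.sum_congr rfl fun i hi => ?_
  have hi' : i ≤ n := Nat.lt_succ_iff.1 (Finset.mem_range.1 hi)
  have hc : (n.choose i : ℂ) * i.factorial * (n - i).factorial = n.factorial := by
    exact_mod_cast Nat.choose_mul_factorial_mul_factorial hi'
  have h1 : (i.factorial : ℂ) ≠ 0 := by exact_mod_cast i.factorial_ne_zero
  have h2 : ((n - i).factorial : ℂ) ≠ 0 := by exact_mod_cast (n - i).factorial_ne_zero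
  have h3 : (n.factorial : ℂ) ≠ 0 := by exact_mod_cast n.factorial_ne_zero
  simp only [coeff_taylorSeries, taylorCoeff]
  field_simp
  rw [← hc]
  ring

theorem taylorSeries_pow {g : ℂ → ℂ} (hg : AnalyticAt ℂ g 0) (n : ℕ) :
    taylorSeries (fun z => g z ^ n) = taylorSeries g ^ n := by
  induction n with
  | zero =>
    ext n
    cases n <;> simp [taylorCoeff, coeff_one, iteratedDeriv_const]
  | succ n ih =>
    simp only [pow_succ]
    rw [taylorSeries_mul (hg.fun_pow n) hg, ih]

theorem taylorSeries_const (a : ℂ) : taylorSeries (fun _ => a) = C a := by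
  ext n
  cases n <;> simp [taylorCoeff, coeff_C, iteratedDeriv_const]

theorem taylorSeries_id : taylorSeries (fun z => z) = X := by
  ext n
  rcases n with _ | _ | n
  · simp [taylorCoeff]
  · simp [taylorCoeff]
  · simp [taylorCoeff, coeff_X, iteratedDeriv_fun_id]

theorem taylorSeries_id_pow (n : ℕ) : taylorSeries (fun z => z ^ n) = X ^ n := by
  rw [← taylorSeries_id]
  exact taylorSeries_pow analyticAt_id n

theorem taylorSeries_deriv (g : ℂ → ℂ) :
    taylorSeries (deriv g) = d⁄dX ℂ (taylorSeries g) := by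
  ext n
  rw [coeff_derivative, coeff_taylorSeries, coeff_taylorSeries, taylorCoeff, taylorCoeff,
    iteratedDeriv_succ', Nat.factorial_succ]
  have h1 : (n.factorial : ℂ) ≠ 0 := by exact_mod_cast n.factorial_ne_zero
  have h2 : (n + 1 : ℂ) ≠ 0 := by exact_mod_cast n.succ_ne_zero
  push_cast
  field_simp

/-- An analytic germ whose Taylor polynomial of degree `2` vanishes is divisible by `z ^ 3`. -/
theorem exists_eq_cube_mul {H : ℂ → ℂ} (hH : AnalyticAt ℂ H 0)
    (h : ∀ i < 3, coeff i (taylorSeries H) = 0) :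
    ∃ g : ℂ → ℂ, AnalyticAt ℂ g 0 ∧ ∀ᶠ z in 𝓝 0, H z = z ^ 3 * g z := by
  have h3 : ((3 : ℕ) : ℕ∞) ≤ analyticOrderAt H 0 := by
    rw [natCast_le_analyticOrderAt_iff_iteratedDeriv_eq_zero hH]
    intro i hi
    have := h i hi
    rw [coeff_taylorSeries, taylorCoeff, div_eq_zero_iff] at this
    exact this.resolve_right (by exact_mod_cast i.factorial_ne_zero)
  obtain ⟨g, hg, hgH⟩ := (natCast_le_analyticOrderAt hH).1 h3
  exact ⟨g, hg, by simpa using hgH⟩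

/-! ### The sine amplitude -/

theorem ellipticF_zero (k : ℂ) : ellipticF k 0 = 0 := by simp [ellipticF]

/-- Near `0` the derivative of the elliptic integral is its integrand. -/
theorem eventually_hasDerivAt_ellipticF (k : ℂ) :
    ∀ᶠ w in 𝓝 (0 : ℂ), (1 - w ^ 2) * (1 - k ^ 2 * w ^ 2) ≠ 0 ∧ HasDerivAt (ellipticF k)
      (1 / ((1 - w ^ 2) * (1 - k ^ 2 * w ^ 2)) ^ (1 / 2 : ℂ)) w := by
  set p : ℂ → ℂ := fun t => (1 - t ^ 2) * (1 - k ^ 2 * t ^ 2) with hp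
  set g : ℂ → ℂ := fun t => 1 / (p t) ^ (1 / 2 : ℂ) with hg
  have hpc : Continuous p := by fun_prop
  have hp0 : p 0 = 1 := by simp [hp]
  have hev : ∀ᶠ t in 𝓝 (0 : ℂ), p t ∈ Complex.slitPlane := by
    apply hpc.continuousAt.eventually
    rw [hp0]
    exact Complex.isOpen_slitPlane.mem_nhds Complex.one_mem_slitPlane
  obtain ⟨r, hr, hball⟩ := Metric.eventually_nhds_iff_ball.1 hev
  have hgd : DifferentiableOn ℂ g (Metric.ball 0 r) := by
    intro t ht
    have h1 : DifferentiableAt ℂ (fun t => p t ^ (1 / 2 : ℂ)) t :=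
      DifferentiableAt.cpow_const (by fun_prop) (hball t ht)
    have h2 : p t ^ (1 / 2 : ℂ) ≠ 0 := by
      rw [Complex.cpow_def_of_ne_zero (Complex.slitPlane_ne_zero (hball t ht))]
      exact Complex.exp_ne_zero _
    exact ((differentiableAt_const (1 : ℂ)).div h1 h2).differentiableWithinAt
  -- A holomorphic primitive on the ball; along segments from 0 it agrees with the integral up to a
  -- constant, so nothing is differentiated under the integral sign.
  obtain ⟨G, hG⟩ := hgd.isExactOn_ball
  have hF : ∀ w ∈ Metric.ball (0 : ℂ) r, ellipticF k w = G w - G 0 := by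
    intro w hw
    have hsw : ∀ s ∈ Set.uIcc (0 : ℝ) 1, (s : ℂ) * w ∈ Metric.ball (0 : ℂ) r := by
      intro s hs
      rw [Set.uIcc_of_le zero_le_one] at hs
      rw [mem_ball_zero_iff] at hw ⊢
      rw [norm_mul, Complex.norm_real, Real.norm_of_nonneg hs.1]
      exact lt_of_le_of_lt (mul_le_of_le_one_left (norm_nonneg _) hs.2) hw
    have hd : ∀ s ∈ Set.uIcc (0 : ℝ) 1,
        HasDerivAt (fun s : ℝ => G ((s : ℂ) * w)) (w * g ((s : ℂ) * w)) s := by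
      intro s hs
      have h1 : HasDerivAt (fun s : ℝ => (s : ℂ) * w) w s := by
        simpa using (Complex.ofRealCLM.hasDerivAt (x := s)).mul_const w
      have h2 := (hG _ (hsw s hs)).comp s h1
      simpa [mul_comm, Function.comp_def] using h2
    have hc : ContinuousOn (fun s : ℝ => w * g ((s : ℂ) * w)) (Set.uIcc (0 : ℝ) 1) := by
      refine continuousOn_const.mul (hgd.continuousOn.comp (by fun_prop) ?_)
      exact fun s hs => hsw s hs
    have := intervalIntegral.integral_eq_sub_of_hasDerivAt hd hc.intervalIntegrable
    simpa [ellipticF, hg, hp] using this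
  filter_upwards [Metric.ball_mem_nhds (0 : ℂ) hr] with w hw
  refine ⟨Complex.slitPlane_ne_zero (hball w hw), ?_⟩
  refine ((hG w hw).sub_const (G 0)).congr_of_eventuallyEq ?_
  filter_upwards [Metric.isOpen_ball.mem_nhds hw] with u hu using hF u hu

theorem analyticAt_sn (k : ℂ) : AnalyticAt ℂ (sn k) 0 := by
  have h := (analyticAt_ellipticF k).analyticAt_localInverse (deriv_ellipticF_ne_zero k)
  rwa [ellipticF_zero] at h

theorem sn_zero (k : ℂ) : sn k 0 = 0 := by
  have h : sn k (ellipticF k 0) = 0 := HasStrictFDerivAt.localInverse_apply_image ..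
  rwa [ellipticF_zero] at h

theorem eventually_ellipticF_sn (k : ℂ) : ∀ᶠ z in 𝓝 (0 : ℂ), ellipticF k (sn k z) = z := by
  have h : ∀ᶠ z in 𝓝 (ellipticF k 0), ellipticF k (sn k z) = z :=
    (analyticAt_ellipticF k).hasStrictDerivAt.eventually_right_inverse (deriv_ellipticF_ne_zero k)
  rwa [ellipticF_zero] at h

/-- The chain rule applied to the right-inverse identity gives sn' as the principal square root;
squaring removes the choice of branch. -/
theorem eventually_deriv_sn_sq (k : ℂ) : ∀ᶠ z in 𝓝 (0 : ℂ),
    deriv (sn k) z ^ 2 = (1 - sn k z ^ 2) * (1 - k ^ 2 * sn k z ^ 2) := by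
  have hcont : Filter.Tendsto (sn k) (𝓝 0) (𝓝 0) := by
    have := (analyticAt_sn k).continuousAt.tendsto
    rwa [sn_zero] at this
  filter_upwards [hcont.eventually (eventually_hasDerivAt_ellipticF k),
    (eventually_ellipticF_sn k).eventually_nhds,
    (analyticAt_sn k).eventually_analyticAt] with z hF hinv hsn
  obtain ⟨hne, hF⟩ := hF
  have h1 := hF.comp z hsn.differentiableAt.hasDerivAt
  have h2 : HasDerivAt (ellipticF k ∘ sn k) 1 z := (hasDerivAt_id z).congr_of_eventuallyEq hinv
  have h3 := h1.unique h2
  set P := (1 - sn k z ^ 2) * (1 - k ^ 2 * sn k z ^ 2)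
  have hsq : (P ^ (1 / 2 : ℂ)) ^ 2 = P := by
    rw [← Complex.cpow_nat_mul]
    norm_num
  have hne' : P ^ (1 / 2 : ℂ) ≠ 0 := by
    intro h0
    rw [h0] at hsq
    exact hne (by rw [← hsq]; simp)
  have h4 : deriv (sn k) z = P ^ (1 / 2 : ℂ) := by
    field_simp at h3
    exact h3
  rw [h4, hsq]

theorem deriv_sn_zero (k : ℂ) : deriv (sn k) 0 = 1 := by
  have h1 : HasDerivAt (ellipticF k) 1 (sn k 0) := by
    rw [sn_zero]; exact (ellipticF_aux k).2
  have h2 := h1.comp 0 (analyticAt_sn k).differentiableAt.hasDerivAt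
  have h3 : HasDerivAt (ellipticF k ∘ sn k) 1 0 :=
    (hasDerivAt_id (0 : ℂ)).congr_of_eventuallyEq (eventually_ellipticF_sn k)
  simpa using h2.unique h3

/-! ### The formal differential equation of `sn²` -/

theorem derivative_ofNat (n : ℕ) [n.AtLeastTwo] :
    d⁄dX ℂ (ofNat(n) : ℂ⟦X⟧) = 0 :=
  (d⁄dX ℂ).map_natCast n

theorem derivative_rescale (a : ℂ) (y : ℂ⟦X⟧) :
    d⁄dX ℂ (rescale a y) = C a * rescale a (d⁄dX ℂ y) := by
  ext n
  simp only [coeff_derivative, coeff_rescale, coeff_C_mul, pow_succ]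
  ring

theorem ofNat_eq_C (n : ℕ) [n.AtLeastTwo] : (OfNat.ofNat n : ℂ⟦X⟧) = C (OfNat.ofNat n : ℂ) :=
  (map_ofNat C n).symm

/-- A formal solution of `δ'' = h δ` with vanishing initial data is zero. -/
theorem eq_zero_of_derivative_derivative_eq_mul {δ h : ℂ⟦X⟧}
    (h0 : coeff 0 δ = 0) (h1 : coeff 1 δ = 0) (hδ : d⁄dX ℂ (d⁄dX ℂ δ) = h * δ) : δ = 0 := by
  ext n
  induction n using Nat.strong_induction_on with
  | _ n ih =>
    rcases n with _ | _ | n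
    · simpa using h0
    · simpa using h1
    · have hc := congrArg (coeff n) hδ
      rw [coeff_mul, Finset.sum_eq_zero, coeff_derivative, coeff_derivative] at hc
      · have h2 : ((n + 1 : ℕ) : ℂ) + 1 ≠ 0 := by exact_mod_cast (n + 1).succ_ne_zero
        have h3 : (n : ℂ) + 1 ≠ 0 := by exact_mod_cast n.succ_ne_zero
        exact (mul_eq_zero.1 ((mul_eq_zero.1 hc).resolve_right h3)).resolve_right h2
      · intro p hp
        have hp' := Finset.HasAntidiagonal.mem_antidiagonal.1 hp
        rw [ih p.2 (by omega)]
        simp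

/-- The recursion for the coefficients of a formal solution of `t'' = a + b t + c t²`. -/
theorem coeff_succ_succ_of_quadratic {t : ℂ⟦X⟧} {a b c : ℂ}
    (ht : d⁄dX ℂ (d⁄dX ℂ t) = C a + C b * t + C c * t ^ 2) (n : ℕ) :
    coeff (n + 2) t * ((n + 2) * (n + 1)) = (if n = 0 then a else 0) + b * coeff n t
      + c * ∑ p ∈ Finset.HasAntidiagonal.antidiagonal n, coeff p.1 t * coeff p.2 t := by
  have h := congrArg (coeff n) ht
  rw [coeff_derivative, coeff_derivative, sq] at h
  simp only [map_add, coeff_C_mul] at h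
  rw [coeff_mul, coeff_C] at h
  rw [← h]
  push_cast
  ring

/-- The first order equation `y'² = 4y(1 - y)(1 - my)` of `sn²`. -/
def IsSnSq (m : ℂ) (y : ℂ⟦X⟧) : Prop :=
  coeff 0 y = 0 ∧ y ≠ 0 ∧ (d⁄dX ℂ y) ^ 2 = 4 * y * (1 - y) * (1 - C m * y)

theorem taylorSeries_sn_sq (k : ℂ) :
    IsSnSq (k ^ 2) (taylorSeries fun z => sn k z ^ 2) := by
  have hsn := analyticAt_sn k
  have hσ : (d⁄dX ℂ (taylorSeries (sn k))) ^ 2 =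
      (1 - taylorSeries (sn k) ^ 2) * (1 - C (k ^ 2) * taylorSeries (sn k) ^ 2) := by
    rw [← taylorSeries_deriv, ← taylorSeries_pow hsn.deriv,
      taylorSeries_congr (eventually_deriv_sn_sq k), taylorSeries_mul (by fun_prop) (by fun_prop),
      taylorSeries_sub (by fun_prop) (by fun_prop), taylorSeries_sub (by fun_prop) (by fun_prop),
      taylorSeries_mul (by fun_prop) (by fun_prop), taylorSeries_pow hsn, taylorSeries_const,
      taylorSeries_const, map_one]
  rw [taylorSeries_pow hsn]
  refine ⟨?_, ?_, ?_⟩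
  · rw [← taylorSeries_pow hsn, coeff_zero_taylorSeries, sn_zero]
    simp
  · intro h0
    have h1 := coeff_one_taylorSeries (sn k)
    rw [pow_eq_zero_iff two_ne_zero |>.1 h0, deriv_sn_zero] at h1
    simp at h1
  · rw [derivative_pow]
    simp only [Nat.cast_ofNat, Nat.add_one_sub_one, pow_one]
    linear_combination 4 * taylorSeries (sn k) ^ 2 * hσ

namespace IsSnSq

variable {m : ℂ} {y : ℂ⟦X⟧}

theorem constantCoeff_eq (hy : IsSnSq m y) : constantCoeff y = 0 := by
  rw [← coeff_zero_eq_constantCoeff_apply]; exact hy.1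

theorem one_sub_mul_ne_zero (hy : IsSnSq m y) (a : ℂ⟦X⟧) : 1 - a * y ≠ 0 := by
  intro h
  have := congrArg constantCoeff h
  simp [hy.constantCoeff_eq] at this

theorem derivative_ne_zero (hy : IsSnSq m y) : d⁄dX ℂ y ≠ 0 := by
  intro h0
  have h := hy.2.2
  rw [h0] at h
  have h1 := hy.one_sub_mul_ne_zero 1
  rw [one_mul] at h1
  have h2 := hy.one_sub_mul_ne_zero (C m)
  have h4 : (4 : ℂ⟦X⟧) ≠ 0 := by
    rw [ofNat_eq_C]
    simp
  exact mul_ne_zero (mul_ne_zero (mul_ne_zero h4 hy.2.1) h1) h2 (by rw [← h]; simp)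

/-- Differentiating the first-order equation produces 2y' times this identity, and y' ≠ 0 cancels.
Unlike the first-order equation, which y = 0 also solves, this one determines the series from its
initial data. -/
theorem second_order (hy : IsSnSq m y) :
    d⁄dX ℂ (d⁄dX ℂ y) = 2 - 4 * (1 + C m) * y + 6 * C m * y ^ 2 := by
  have h := congrArg (d⁄dX ℂ) hy.2.2
  simp only [Derivation.leibniz, Derivation.leibniz_pow, map_sub, derivative_ofNat,
    derivative_one, derivative_C, smul_eq_mul] at h
  have h2 : (2 : ℂ⟦X⟧) ≠ 0 := by
    rw [ofNat_eq_C]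
    simp
  apply mul_left_cancel₀ (mul_ne_zero h2 hy.derivative_ne_zero)
  simp only [nsmul_eq_mul, Nat.cast_ofNat, Nat.add_one_sub_one, pow_one] at h
  linear_combination h

theorem coeff_one (hy : IsSnSq m y) : coeff 1 y = 0 := by
  have h := congrArg (coeff 0) hy.2.2
  have h0 := hy.constantCoeff_eq
  have h1 : constantCoeff (d⁄dX ℂ y) = coeff 1 y := by
    rw [← coeff_zero_eq_constantCoeff_apply, coeff_derivative]
    simp
  simpa [h0, h1] using h

theorem coeff_succ_succ (hy : IsSnSq m y) (n : ℕ) :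
    coeff (n + 2) y * ((n + 2) * (n + 1)) = (if n = 0 then 2 else 0)
      - 4 * (1 + m) * coeff n y
      + 6 * m * ∑ p ∈ Finset.HasAntidiagonal.antidiagonal n, coeff p.1 y * coeff p.2 y := by
  have e : d⁄dX ℂ (d⁄dX ℂ y) = C 2 + C (-(4 * (1 + m))) * y + C (6 * m) * y ^ 2 := by
    rw [hy.second_order]
    simp only [map_neg, map_mul, map_add, map_ofNat, map_one]
    ring
  rw [coeff_succ_succ_of_quadratic e]
  ring

theorem coeff_two (hy : IsSnSq m y) : coeff 2 y = 1 := by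
  have h := hy.coeff_succ_succ 0
  have h0 := hy.constantCoeff_eq
  simp [h0] at h
  exact h

theorem coeff_three (hy : IsSnSq m y) : coeff 3 y = 0 := by
  have h := hy.coeff_succ_succ 1
  simp [hy.coeff_one, hy.constantCoeff_eq, Finset.Nat.antidiagonal_succ] at h
  norm_num at h
  exact h

theorem coeff_four (hy : IsSnSq m y) : coeff 4 y = -(1 + m) / 3 := by
  have h := hy.coeff_succ_succ 2
  simp [hy.coeff_one, hy.coeff_two, hy.constantCoeff_eq, Finset.Nat.antidiagonal_succ] at h
  linear_combination h / 12

/-- The duplication formula `sn²(2z) (1 - m sn⁴ z)² = 4 sn² z cn² z dn² z`. -/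
theorem duplication (hy : IsSnSq m y) :
    rescale 2 y * (1 - C m * y ^ 2) ^ 2 = 4 * y * (1 - y) * (1 - C m * y) := by
  have h0 := hy.constantCoeff_eq
  have h1 := hy.2.2
  have h2 := hy.second_order
  set M : ℂ⟦X⟧ := C m with hM
  have hDM : d⁄dX ℂ M = 0 := derivative_C
  set Q : ℂ⟦X⟧ := 1 - M * y ^ 2 with hQ
  have hQc : constantCoeff Q ≠ 0 := by simp [hQ, h0]
  have hQ0 : Q ≠ 0 := fun h => hQc (by rw [h]; simp)
  -- `R` is the candidate for sn²(2z). It is shown to solve the same second-order equation, with the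
  -- same initial data, as `rescale 2 y`.
  set R : ℂ⟦X⟧ := 4 * y * (1 - y) * (1 - M * y) * Q⁻¹ ^ 2 with hR
  have hI : Q * Q⁻¹ = 1 := PowerSeries.mul_inv_cancel _ hQc
  have hRQ : R * Q ^ 2 = 4 * y * (1 - y) * (1 - M * y) := by
    rw [hR]
    linear_combination 4 * y * (1 - y) * (1 - M * y) * (Q * Q⁻¹ + 1) * hI
  set y₁ := d⁄dX ℂ y
  set y₂ := d⁄dX ℂ y₁
  have hDQ : d⁄dX ℂ Q = -2 * M * y * y₁ := by
    simp only [hQ, Derivation.leibniz, Derivation.leibniz_pow, map_sub, derivative_one, hDM,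
      smul_eq_mul, nsmul_eq_mul]
    push_cast
    ring
  have hR1 := congrArg (d⁄dX ℂ) hRQ
  simp only [Derivation.leibniz, Derivation.leibniz_pow, map_sub, derivative_one, hDM, hDQ,
    derivative_ofNat, smul_eq_mul, nsmul_eq_mul] at hR1
  set R₁ := d⁄dX ℂ R
  have hR1' : R₁ * Q ^ 3 = y₁ * (4 * (1 - 2 * (1 + M) * y + 6 * M * y ^ 2
      - 2 * M * (1 + M) * y ^ 3 + M ^ 2 * y ^ 4)) := by
    push_cast at hR1
    simp only [pow_one] at hR1
    linear_combination Q * hR1 + 4 * M * y * y₁ * hRQ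
  have hR2 := congrArg (d⁄dX ℂ) hR1'
  simp only [Derivation.leibniz, Derivation.leibniz_pow, map_sub, map_add, derivative_one, hDM,
    hDQ, derivative_ofNat, smul_eq_mul, nsmul_eq_mul] at hR2
  set R₂ := d⁄dX ℂ R₁
  -- After multiplication by Q⁴, the equations for y'² and y'' eliminate the derivatives of y; what
  -- remains is the polynomial identity `key` in y and M.
  have hODE : R₂ = 4 * (2 - 4 * (1 + M) * R + 6 * M * R ^ 2) := by
    push_cast at hR2
    simp only [pow_one] at hR2
    apply mul_left_cancel₀ (pow_ne_zero 4 hQ0)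
    have key : Q * (4 * y * (1 - y) * (1 - M * y) * (4 * (-2 * (1 + M) + 12 * M * y
          - 6 * M * (1 + M) * y ^ 2 + 4 * M ^ 2 * y ^ 3))
        + 4 * (1 - 2 * (1 + M) * y + 6 * M * y ^ 2 - 2 * M * (1 + M) * y ^ 3 + M ^ 2 * y ^ 4)
          * (2 - 4 * (1 + M) * y + 6 * M * y ^ 2))
        + 24 * M * y * (4 * y * (1 - y) * (1 - M * y)) * (1 - 2 * (1 + M) * y + 6 * M * y ^ 2
          - 2 * M * (1 + M) * y ^ 3 + M ^ 2 * y ^ 4)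
        = 4 * (2 * Q ^ 4 - 4 * (1 + M) * (4 * y * (1 - y) * (1 - M * y)) * Q ^ 2
          + 6 * M * (4 * y * (1 - y) * (1 - M * y)) ^ 2) := by
      rw [hQ]
      ring
    change _ = y₁ * (4 * (0 - (2 * (1 + M) * y₁ + _) + (6 * M * (2 * (y * y₁)) + _)
      - (2 * M * (1 + M) * (3 * (y ^ 2 * y₁)) + _) + (M ^ 2 * (4 * (y ^ 3 * y₁)) + _)) + _)
      + _ * y₂ at hR2
    linear_combination Q * hR2 + 6 * M * y * y₁ * hR1'
      + (4 * Q * (-2 * (1 + M) + 12 * M * y - 6 * M * (1 + M) * y ^ 2 + 4 * M ^ 2 * y ^ 3)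
        + 24 * M * y * (1 - 2 * (1 + M) * y + 6 * M * y ^ 2 - 2 * M * (1 + M) * y ^ 3
          + M ^ 2 * y ^ 4)) * h1
      + 4 * Q * (1 - 2 * (1 + M) * y + 6 * M * y ^ 2 - 2 * M * (1 + M) * y ^ 3
          + M ^ 2 * y ^ 4) * h2
      + (16 * (1 + M) * Q ^ 2 - 24 * M * (R * Q ^ 2 + 4 * y * (1 - y) * (1 - M * y))) * hRQ
      + key
  have hS : d⁄dX ℂ (d⁄dX ℂ (rescale 2 y)) =
      4 * (2 - 4 * (1 + M) * rescale 2 y + 6 * M * (rescale 2 y) ^ 2) := by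
    have hC (a : ℂ) : rescale 2 (C a) = C a := by
      ext n
      rw [coeff_rescale, coeff_C]
      split_ifs with hn <;> simp [hn]
    rw [derivative_rescale, Derivation.leibniz, derivative_C, derivative_rescale]
    change _ • (_ * rescale 2 y₂) + _ = _
    rw [h2]
    simp only [map_add, map_sub, map_mul, map_pow, map_ofNat, map_one, hC, hM, smul_eq_mul,
      mul_zero]
    ring
  have hz : rescale 2 y - R = 0 := by
    -- Subtracting the two equations, the difference of squares factors, so the difference solves a
    -- linear equation whose coefficient involves the sum of the two solutions.
    apply eq_zero_of_derivative_derivative_eq_mul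
      (h := 4 * (-4 * (1 + M) + 6 * M * (rescale 2 y + R)))
    · rw [map_sub, coeff_rescale, hy.1]
      simp [hR, h0]
    · have hR1c : coeff 1 R = constantCoeff R₁ := by
        rw [← coeff_zero_eq_constantCoeff_apply, coeff_derivative]
        simp
      have h3 := congrArg constantCoeff hR1'
      have hy1 : constantCoeff y₁ = 0 := by
        rw [← coeff_zero_eq_constantCoeff_apply, coeff_derivative]
        simp [hy.coeff_one]
      simp [hy1, hQ, h0] at h3
      rw [map_sub, coeff_rescale, hR1c, h3, hy.coeff_one]
      simp
    · rw [map_sub, map_sub, hS]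
      change _ - R₂ = _
      rw [hODE]
      ring
  rw [sub_eq_zero.1 hz, hRQ]

end IsSnSq

/-! ### The generating series of the coefficients -/

/-- The Taylor series of `sn²` at `0`. -/
noncomputable def snSqSeries (k : ℂ) : ℂ⟦X⟧ := taylorSeries fun z => sn k z ^ 2

theorem isSnSq_snSqSeries (k : ℂ) : IsSnSq (k ^ 2) (snSqSeries k) := taylorSeries_sn_sq k

theorem analyticAt_inv_of_ne_zero {g : ℂ → ℂ} (hg : AnalyticAt ℂ g 0) (h0 : g 0 ≠ 0) :
    AnalyticAt ℂ (fun z => 1 / g z) 0 :=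
  analyticAt_const.fun_div hg h0

theorem taylorSeries_inv_mul {g : ℂ → ℂ} (hg : AnalyticAt ℂ g 0) (h0 : g 0 ≠ 0) :
    taylorSeries (fun z => 1 / g z) * taylorSeries g = 1 := by
  rw [← taylorSeries_mul (analyticAt_inv_of_ne_zero hg h0) hg, ← map_one (C (R := ℂ)),
    ← taylorSeries_const]
  apply taylorSeries_congr
  filter_upwards [hg.continuousAt.eventually_ne h0] with z hz
  exact one_div_mul_cancel hz

theorem analyticAt_one_sub_mul_sn_sq (k a : ℂ) : AnalyticAt ℂ (fun z => 1 - a * sn k z ^ 2) 0 := by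
  have := analyticAt_sn k
  fun_prop

theorem one_sub_mul_sn_sq_zero_ne (k a : ℂ) : 1 - a * sn k 0 ^ 2 ≠ 0 := by
  simp [sn_zero]

theorem taylorSeries_one_sub_mul_sn_sq (k a : ℂ) :
    taylorSeries (fun z => 1 - a * sn k z ^ 2) = 1 - C a * snSqSeries k := by
  have := analyticAt_sn k
  rw [taylorSeries_sub (by fun_prop) (by fun_prop), taylorSeries_mul (by fun_prop) (by fun_prop),
    taylorSeries_const, taylorSeries_const, map_one, snSqSeries]

theorem taylorSeries_ndSq_mul (k : ℂ) :
    taylorSeries (ndSq k) * (1 - C (k ^ 2) * snSqSeries k) = 1 := by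
  rw [← taylorSeries_one_sub_mul_sn_sq]
  exact taylorSeries_inv_mul (analyticAt_one_sub_mul_sn_sq k _) (one_sub_mul_sn_sq_zero_ne k _)

theorem ncSq_eq (k : ℂ) : ncSq k = fun z => 1 / (1 - 1 * sn k z ^ 2) := by
  ext z
  simp [ncSq]

theorem taylorSeries_ncSq_mul (k : ℂ) :
    taylorSeries (ncSq k) * (1 - snSqSeries k) = 1 := by
  have h := taylorSeries_inv_mul (analyticAt_one_sub_mul_sn_sq k 1)
    (one_sub_mul_sn_sq_zero_ne k 1)
  rw [taylorSeries_one_sub_mul_sn_sq] at h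
  rwa [map_one, one_mul, ← ncSq_eq] at h

theorem taylorSeries_mul_sub_one {g : ℂ → ℂ} (hg : AnalyticAt ℂ g 0) (a : ℂ) :
    taylorSeries (fun z => a * (g z - 1)) = C a * (taylorSeries g - 1) := by
  rw [taylorSeries_mul (by fun_prop) (by fun_prop), taylorSeries_sub (by fun_prop) (by fun_prop),
    taylorSeries_const, taylorSeries_const, map_one]

theorem d_eq_coeff (j : ℕ) (k : ℂ) :
    d j k = coeff (2 * j) (C (1 - k ^ 2) * (taylorSeries (ndSq k) - 1)) := by
  rw [← taylorSeries_mul_sub_one, coeff_taylorSeries, d]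
  exact analyticAt_inv_of_ne_zero (analyticAt_one_sub_mul_sn_sq k _)
    (one_sub_mul_sn_sq_zero_ne k _)

theorem e_eq_coeff (j : ℕ) (k : ℂ) :
    e j k = coeff (2 * j) (C (1 - k ^ 2) * (taylorSeries (ncSq k) - 1)) := by
  rw [← taylorSeries_mul_sub_one, coeff_taylorSeries, e]
  rw [ncSq_eq]
  exact analyticAt_inv_of_ne_zero (analyticAt_one_sub_mul_sn_sq k 1)
    (one_sub_mul_sn_sq_zero_ne k 1)

theorem f_eq_coeff (j : ℕ) (k : ℂ) :
    f j k = coeff (2 * j) (-(C (k ^ 2) * snSqSeries k)) := by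
  have h := taylorSeries_mul_sub_one (analyticAt_one_sub_mul_sn_sq k (k ^ 2)) 1
  rw [taylorSeries_one_sub_mul_sn_sq] at h
  simp only [one_mul, map_one, sub_sub_cancel_left] at h
  rw [← h, coeff_taylorSeries]
  simp only [f, dnSq, sub_sub_cancel_left]

/-- The regular part of `ns²`, as a power series `γ` with `sn² (1 + (1 + k²)/3 z² + z² γ) = z²`. -/
theorem exists_nsSq_series (k : ℂ) : ∃ γ : ℂ⟦X⟧, (∀ j, c j k = coeff (2 * j) γ) ∧
    snSqSeries k * (1 + C ((1 + k ^ 2) / 3) * X ^ 2 + X ^ 2 * γ) = X ^ 2 := by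
  have hsn := analyticAt_sn k
  have hy := isSnSq_snSqSeries k
  obtain ⟨g, hg, hgsn⟩ : ∃ g : ℂ → ℂ, AnalyticAt ℂ g 0 ∧ ∀ᶠ z in 𝓝 0, sn k z = z * g z := by
    have h1 : ((1 : ℕ) : ℕ∞) ≤ analyticOrderAt (sn k) 0 := by
      rw [natCast_le_analyticOrderAt_iff_iteratedDeriv_eq_zero hsn]
      intro i hi
      obtain rfl : i = 0 := by omega
      simp [sn_zero]
    obtain ⟨g, hg, h⟩ := (natCast_le_analyticOrderAt hsn).1 h1
    exact ⟨g, hg, by simpa using h⟩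
  have hg0 : g 0 ≠ 0 := by
    have h1 : deriv (sn k) 0 = deriv (fun z => z * g z) 0 :=
      Filter.EventuallyEq.deriv_eq hgsn
    rw [deriv_sn_zero, deriv_fun_mul differentiableAt_fun_id hg.differentiableAt] at h1
    simp at h1
    simp [← h1]
  have hg2 : AnalyticAt ℂ (fun z => g z ^ 2) 0 := by fun_prop
  have hinv := analyticAt_inv_of_ne_zero hg2 (pow_ne_zero 2 hg0)
  -- `V` is the series of z² ns²(z); its coefficients up to degree 2 follow from those of sn² up to
  -- degree 4.
  set V := taylorSeries fun z => 1 / g z ^ 2 with hV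
  have hVU : V * taylorSeries (fun z => g z ^ 2) = 1 :=
    taylorSeries_inv_mul hg2 (pow_ne_zero 2 hg0)
  have hyU : snSqSeries k = X ^ 2 * taylorSeries (fun z => g z ^ 2) := by
    rw [← taylorSeries_id_pow,
      ← taylorSeries_mul (by fun_prop) hg2, snSqSeries]
    apply taylorSeries_congr
    filter_upwards [hgsn] with z hz
    rw [hz, mul_pow]
  have hyV : V * snSqSeries k = X ^ 2 := by
    rw [hyU]
    linear_combination X ^ 2 * hVU
  have hv0 : constantCoeff V = 1 := by
    have h := congrArg (coeff 2) hyV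
    simpa [coeff_mul, Finset.Nat.antidiagonal_succ, coeff_X_pow, hy.coeff_one, hy.coeff_two,
      hy.constantCoeff_eq] using h
  have hv1 : coeff 1 V = 0 := by
    have h := congrArg (coeff 3) hyV
    simpa [coeff_mul, Finset.Nat.antidiagonal_succ, coeff_X_pow, hy.coeff_one, hy.coeff_two,
      hy.constantCoeff_eq, hy.coeff_three] using h
  have hv2 : coeff 2 V = (1 + k ^ 2) / 3 := by
    have h := congrArg (coeff 4) hyV
    simp [coeff_mul, Finset.Nat.antidiagonal_succ, coeff_X_pow, hy.coeff_one, hy.coeff_two,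
      hy.constantCoeff_eq, hy.coeff_three, hy.coeff_four, hv0] at h
    linear_combination h
  set H : ℂ → ℂ := fun z => 1 / g z ^ 2 - (1 + (1 + k ^ 2) / 3 * z ^ 2) with hH
  have hHan : AnalyticAt ℂ H 0 := hinv.fun_sub (by fun_prop)
  have hHs : taylorSeries H = V - (1 + C ((1 + k ^ 2) / 3) * X ^ 2) := by
    rw [hH, taylorSeries_sub hinv (by fun_prop), taylorSeries_add (by fun_prop) (by fun_prop),
      taylorSeries_mul (by fun_prop) (by fun_prop), taylorSeries_id_pow,
      taylorSeries_const, taylorSeries_const, map_one]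
  -- Divisibility by z³, not merely z², makes the regular part equal to z h(z), which vanishes at 0
  -- and so matches the value assigned there by `Function.update`.
  obtain ⟨h, hh, hHh⟩ := exists_eq_cube_mul hHan (by
    intro i hi
    rw [hHs]
    interval_cases i
    · simp [hv0]
    · simp [hv1, coeff_one, coeff_X_pow]
    · simp [hv2, coeff_one, coeff_X_pow])
  refine ⟨taylorSeries fun z => z * h z, fun j => ?_, ?_⟩
  · rw [c, ← coeff_taylorSeries]
    congr 1
    apply taylorSeries_congr
    filter_upwards [hHh, hgsn] with z hz hgz
    by_cases hz0 : z = 0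
    · simp [hz0]
    · rw [Function.update_of_ne hz0, nsSq, hgz]
      have h3 : 1 / (z * g z) ^ 2 = 1 / g z ^ 2 / z ^ 2 := by
        rw [mul_pow, div_div, mul_comm]
      have h4 : 1 / g z ^ 2 = z ^ 3 * h z + (1 + (1 + k ^ 2) / 3 * z ^ 2) := by
        rw [← hz, hH]; ring
      rw [h3, h4]
      field_simp
      ring
  · have h5 : X ^ 2 * taylorSeries (fun z => z * h z) = taylorSeries H := by
      rw [taylorSeries_congr hHh, ← taylorSeries_id_pow,
        ← taylorSeries_mul (by fun_prop) (by fun_prop)]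
      congr 1
      ext z
      ring
    rw [h5, hHs]
    linear_combination hyV

/-- The duplication formula for `ns²`, read off on coefficients. -/
theorem coeff_relation (j : ℕ) (k : ℂ) :
    (2 ^ (2 * j + 2) - 1) * c j k + d j k - e j k + f j k = 0 := by
  obtain ⟨γ, hγ, hG⟩ := exists_nsSq_series k
  have hy := isSnSq_snSqSeries k
  have hdup := hy.duplication
  have hN := taylorSeries_ncSq_mul k
  have hD := taylorSeries_ndSq_mul k
  rw [hγ, d_eq_coeff, e_eq_coeff, f_eq_coeff]
  set y := snSqSeries k
  set N := taylorSeries (ncSq k)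
  set J := taylorSeries (ndSq k)
  have hG2 := congrArg (rescale 2) hG
  have hC (a : ℂ) : rescale 2 (C a) = C a := by
    ext n
    rw [coeff_rescale, coeff_C]
    split_ifs with hn <;> simp [hn]
  simp only [map_mul, map_add, map_one, map_pow, rescale_X, hC] at hG2
  have hM3 : (3 : ℂ⟦X⟧) * C ((1 + k ^ 2) / 3) = 1 + C (k ^ 2) := by
    rw [ofNat_eq_C, ← map_mul, ← map_one (C (R := ℂ)), ← map_add]
    congr 1
    ring
  have h1m : (C (1 - k ^ 2) : ℂ⟦X⟧) = 1 - C (k ^ 2) := by simp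
  rw [h1m]
  set M : ℂ⟦X⟧ := C (k ^ 2)
  set A : ℂ⟦X⟧ := C ((1 + k ^ 2) / 3)
  have hC2 : (C 2 : ℂ⟦X⟧) = 2 := map_ofNat C 2
  rw [hC2] at hG2
  set Y := rescale 2 y
  set γ' := rescale 2 γ with hγ'
  set G := 1 + A * X ^ 2 + X ^ 2 * γ with hGdef
  set G' := 1 + A * (2 * X) ^ 2 + (2 * X) ^ 2 * γ' with hGdef'
  have h4 : (4 : ℂ⟦X⟧) ≠ 0 := by
    rw [ofNat_eq_C]
    simp
  have hy1 := hy.one_sub_mul_ne_zero 1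
  rw [one_mul] at hy1
  have hy2 := hy.one_sub_mul_ne_zero M
  -- Here G = X²/y and G' = 4X²/Y stand for z² ns²(z) and 4z² ns²(2z), so this is the inverted
  -- duplication formula.
  have hcancel : (1 - y) * (1 - M * y) * G' = G * (1 - M * y ^ 2) ^ 2 := by
    apply mul_left_cancel₀ (mul_ne_zero h4 hy.2.1)
    linear_combination -G' * hdup + (1 - M * y ^ 2) ^ 2 * hG2 - 4 * (1 - M * y ^ 2) ^ 2 * hG
  -- Partial fractions of (1 - My²)² / ((1 - y)(1 - My)), with N = 1/(1 - y) and J = 1/(1 - My).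
  have hsum : G' = G * (1 + y * ((1 + M) + (1 - M) * (N - 1) + M * y - (1 - M) * (J - 1))) := by
    apply mul_left_cancel₀ (mul_ne_zero hy1 hy2)
    linear_combination hcancel
      - G * y * (1 - M) * (1 - M * y) * hN + G * y * (1 - M) * (1 - y) * hD
  -- Since 3A = 1 + M, the constants cancel.
  have hfin : 4 * γ' = γ + (1 - M) * (N - 1) + M * y - (1 - M) * (J - 1) := by
    have hX : (X ^ 2 : ℂ⟦X⟧) ≠ 0 := pow_ne_zero 2 X_ne_zero
    apply mul_left_cancel₀ hX
    rw [hGdef'] at hsum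
    linear_combination hsum + ((1 + M) + (1 - M) * (N - 1) + M * y - (1 - M) * (J - 1)) * hG
      + hGdef - X ^ 2 * hM3
  have hco := congrArg (coeff (2 * j)) hfin
  rw [ofNat_eq_C, map_sub, map_add, map_add, coeff_C_mul, hγ', coeff_rescale] at hco
  rw [map_neg]
  linear_combination hco

/-! ### Polynomiality in `k²` -/

/-- Every Taylor coefficient of `sn²` is a rational polynomial in `k²`. -/
theorem exists_polynomial_coeff_snSqSeries (n : ℕ) : ∃ P : Polynomial ℚ, ∀ k : ℂ,
    coeff n (snSqSeries k) = Polynomial.aeval (k ^ 2) P := by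
  induction n using Nat.strong_induction_on with
  | _ n ih =>
    rcases n with _ | _ | n
    · exact ⟨0, fun k => by rw [(isSnSq_snSqSeries k).1, map_zero]⟩
    · exact ⟨0, fun k => by rw [(isSnSq_snSqSeries k).coeff_one, map_zero]⟩
    · choose! P hP using ih
      refine ⟨Polynomial.C (((n + 2) * (n + 1) : ℚ)⁻¹) * (Polynomial.C (if n = 0 then 2 else 0)
        - 4 * (1 + Polynomial.X) * P n + 6 * Polynomial.X *
          ∑ p ∈ Finset.HasAntidiagonal.antidiagonal n, P p.1 * P p.2), fun k => ?_⟩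
      have h := (isSnSq_snSqSeries k).coeff_succ_succ n
      have hs : ∑ p ∈ Finset.HasAntidiagonal.antidiagonal n,
          coeff p.1 (snSqSeries k) * coeff p.2 (snSqSeries k) =
          ∑ p ∈ Finset.HasAntidiagonal.antidiagonal n,
            Polynomial.aeval (k ^ 2) (P p.1) * Polynomial.aeval (k ^ 2) (P p.2) := by
        refine Finset.sum_congr rfl fun p hp => ?_
        have hp' := Finset.HasAntidiagonal.mem_antidiagonal.1 hp
        rw [hP p.1 (by omega), hP p.2 (by omega)]
      rw [hs, hP n (by omega)] at h
      have h1 : (n + 2 : ℂ) ≠ 0 := by exact_mod_cast (n + 1).succ_ne_zero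
      have h2 : (n + 1 : ℂ) ≠ 0 := by exact_mod_cast n.succ_ne_zero
      rw [← eq_div_iff (mul_ne_zero h1 h2)] at h
      rw [h, div_eq_inv_mul]
      simp only [map_mul, map_add, map_sub, map_sum, Polynomial.aeval_C, Polynomial.aeval_X,
        map_one, map_ofNat, eq_ratCast]
      split_ifs <;> push_cast <;> rfl

/-- Evaluation of a rational polynomial at `k²`. -/
noncomputable def evalSq (k : ℂ) : Polynomial ℚ →+* ℂ :=
  (Polynomial.aeval (k ^ 2) : Polynomial ℚ →ₐ[ℚ] ℂ).toRingHom

theorem evalSq_apply (k : ℂ) (P : Polynomial ℚ) : evalSq k P = Polynomial.aeval (k ^ 2) P := rfl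

/-- Every complex number is some k², so P vanishes on all of ℂ. -/
theorem eq_zero_of_evalSq_eq_zero {P : Polynomial ℚ} (h : ∀ k, evalSq k P = 0) : P = 0 := by
  have h1 : P.map (algebraMap ℚ ℂ) = 0 := by
    apply Polynomial.funext
    intro z
    obtain ⟨k, hk⟩ := IsAlgClosed.exists_pow_nat_eq z two_pos
    rw [Polynomial.eval_map_algebraMap, ← hk, ← evalSq_apply, h, Polynomial.eval_zero]
  exact (Polynomial.map_eq_zero _).1 h1

theorem exists_universal_snSqSeries : ∃ Y : (Polynomial ℚ)⟦X⟧, constantCoeff Y = 0 ∧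
    ∀ k, PowerSeries.map (evalSq k) Y = snSqSeries k := by
  choose P hP using exists_polynomial_coeff_snSqSeries
  refine ⟨PowerSeries.mk P, eq_zero_of_evalSq_eq_zero fun k => ?_, fun k => ?_⟩
  · rw [← coeff_zero_eq_constantCoeff_apply, coeff_mk, evalSq_apply, ← hP,
      (isSnSq_snSqSeries k).1]
  · ext n
    rw [coeff_map, coeff_mk, hP, evalSq_apply]

/-- The constant term of 1 - Y is 1, so inversion introduces no denominators in k²; uniqueness of
inverses identifies each specialization. -/
theorem exists_universal_inverse {Y : (Polynomial ℚ)⟦X⟧} (h0 : constantCoeff Y = 0)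
    (s : ℂ → ℂ⟦X⟧) (hs : ∀ k, s k * (1 - PowerSeries.map (evalSq k) Y) = 1) :
    ∃ J : (Polynomial ℚ)⟦X⟧, J * (1 - Y) = 1 ∧ ∀ k, PowerSeries.map (evalSq k) J = s k := by
  have hJ : (1 - Y) * invOfUnit (1 - Y) 1 = 1 := mul_invOfUnit _ _ (by simp [h0])
  refine ⟨invOfUnit (1 - Y) 1, by rw [mul_comm, hJ], fun k => ?_⟩
  have h1 := congrArg (PowerSeries.map (evalSq k)) hJ
  simp only [map_mul, map_sub, map_one] at h1
  linear_combination s k * h1 - PowerSeries.map (evalSq k) (invOfUnit (1 - Y) 1) * hs k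

theorem evalSq_X (k : ℂ) : evalSq k Polynomial.X = k ^ 2 := by simp [evalSq_apply]

theorem exists_polynomial_f (j : ℕ) : ∃ P, ∀ k, f j k = evalSq k P := by
  obtain ⟨Y, -, hY⟩ := exists_universal_snSqSeries
  refine ⟨coeff (2 * j) (-(C Polynomial.X * Y)), fun k => ?_⟩
  rw [f_eq_coeff, ← coeff_map]
  simp only [map_neg (PowerSeries.map _), map_mul, hY, map_C, evalSq_X]

theorem exists_polynomial_e (j : ℕ) : ∃ P, ∀ k, e j k = evalSq k P := by
  obtain ⟨Y, h0, hY⟩ := exists_universal_snSqSeries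
  obtain ⟨N, -, hN⟩ := exists_universal_inverse h0 (fun k => taylorSeries (ncSq k))
    (fun k => by rw [hY]; exact taylorSeries_ncSq_mul k)
  refine ⟨coeff (2 * j) (C (1 - Polynomial.X) * (N - 1)), fun k => ?_⟩
  rw [e_eq_coeff, ← coeff_map]
  simp only [map_mul, map_sub, map_one, hN, map_C, evalSq_X]

/-- `d_j` is `k²(1 - k²)` times a polynomial in `k²` whose value at `0` is the coefficient of
`z ^ (2j)` in `sin²`. -/
theorem exists_polynomial_d (j : ℕ) : ∃ P : Polynomial ℚ,
    (∀ k, d j k = evalSq k (Polynomial.X * (1 - Polynomial.X) * P)) ∧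
      evalSq 0 P = coeff (2 * j) (snSqSeries 0) := by
  obtain ⟨Y, h0, hY⟩ := exists_universal_snSqSeries
  obtain ⟨J, hJ, hJs⟩ := exists_universal_inverse (Y := C Polynomial.X * Y) (by simp [h0])
    (fun k => taylorSeries (ndSq k)) (fun k => by
      rw [map_mul, map_C, hY, evalSq_X]; exact taylorSeries_ndSq_mul k)
  refine ⟨coeff (2 * j) (Y * J), fun k => ?_, ?_⟩
  · have h1 : C (1 - Polynomial.X) * (J - 1) =
        C (Polynomial.X * (1 - Polynomial.X)) * (Y * J) := by
      rw [map_mul]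
      linear_combination C (1 - Polynomial.X) * hJ
    rw [← coeff_C_mul, ← h1, d_eq_coeff, ← coeff_map]
    simp only [map_mul, map_sub, map_one, hJs, map_C, evalSq_X]
  · have h1 := taylorSeries_ndSq_mul 0
    simp only [ne_eq, OfNat.ofNat_ne_zero, not_false_eq_true, zero_pow, map_zero, zero_mul,
      sub_zero, mul_one] at h1
    rw [← coeff_map, map_mul, hY, hJs, h1, mul_one]

/-- The duplication relation can be solved for c_j because 2^(2j+2) ≠ 1. -/
theorem exists_polynomial_c (j : ℕ) : ∃ P, ∀ k, c j k = evalSq k P := by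
  obtain ⟨Pd, hd, -⟩ := exists_polynomial_d j
  obtain ⟨Pe, he⟩ := exists_polynomial_e j
  obtain ⟨Pf, hf⟩ := exists_polynomial_f j
  refine ⟨Polynomial.C ((2 ^ (2 * j + 2) - 1 : ℚ)⁻¹) *
    (Pe - Polynomial.X * (1 - Polynomial.X) * Pd - Pf), fun k => ?_⟩
  have h := coeff_relation j k
  have hne : (2 ^ (2 * j + 2) - 1 : ℂ) ≠ 0 := by
    rw [sub_ne_zero]
    exact_mod_cast (Nat.one_lt_two_pow (by omega : 2 * j + 2 ≠ 0)).ne'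
  have h1 : evalSq k (Polynomial.C ((2 ^ (2 * j + 2) - 1 : ℚ)⁻¹)) =
      (2 ^ (2 * j + 2) - 1 : ℂ)⁻¹ := by
    simp [evalSq_apply]
  rw [map_mul, map_sub, map_sub, ← hd, ← he, ← hf, h1]
  field_simp
  linear_combination h

/-! ### Nonvanishing -/

open scoped ComplexOrder in
/-- The even Taylor coefficients of `tan²`, the solution of `t'' = 2 + 8t + 6t²`, are nonzero. -/
theorem coeff_ne_zero_of_tan_sq_ode {t : ℂ⟦X⟧} (h0 : coeff 0 t = 0) (h1 : coeff 1 t = 0)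
    (ht : d⁄dX ℂ (d⁄dX ℂ t) = 2 + 8 * t + 6 * t ^ 2) {j : ℕ} (hj : 1 ≤ j) :
    coeff (2 * j) t ≠ 0 := by
  have ht' : d⁄dX ℂ (d⁄dX ℂ t) = C 2 + C 8 * t + C 6 * t ^ 2 := by
    rw [ht]
    simp only [map_ofNat]
  have hrec := coeff_succ_succ_of_quadratic ht'
  have hpos (n : ℕ) : (0 : ℂ) < (n + 2) * (n + 1) := by
    exact_mod_cast (by positivity : 0 < (n + 2) * (n + 1))
  -- All terms of the recursion are nonnegative; strict positivity starts from the constant 2 and is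
  -- propagated by the linear term 8t.
  have hnn (n : ℕ) : 0 ≤ coeff n t := by
    induction n using Nat.strong_induction_on with
    | _ n ih =>
      rcases n with _ | _ | n
      · rw [h0]
      · rw [h1]
      · have h2 : 0 ≤ coeff (n + 2) t * ((n + 2) * (n + 1)) := by
          rw [hrec]
          refine add_nonneg (add_nonneg ?_ (mul_nonneg (by norm_num) (ih n (by omega))))
            (mul_nonneg (by norm_num) (Finset.sum_nonneg fun p hp => ?_))
          · split_ifs <;> norm_num
          · have hp' := Finset.HasAntidiagonal.mem_antidiagonal.1 hp
            exact mul_nonneg (ih _ (by omega)) (ih _ (by omega))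
        have h3 := mul_nonneg h2 (inv_nonneg.2 (hpos n).le)
        rwa [mul_assoc, mul_inv_cancel₀ (hpos n).ne', mul_one] at h3
  have hsum (n : ℕ) : 0 ≤ 6 * ∑ p ∈ Finset.HasAntidiagonal.antidiagonal n,
      coeff p.1 t * coeff p.2 t :=
    mul_nonneg (by norm_num) (Finset.sum_nonneg fun p _ => mul_nonneg (hnn _) (hnn _))
  induction j, hj using Nat.le_induction with
  | base =>
    intro hz
    have h := hrec 0
    rw [mul_one] at hz
    rw [zero_add, hz, h0] at h
    simp [h0] at h
  | succ j hj ih =>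
    intro hz
    have h := hrec (2 * j)
    rw [show 2 * (j + 1) = 2 * j + 2 by ring] at hz
    rw [hz, if_neg (by omega), zero_mul, zero_add] at h
    have hlt : 0 < 8 * coeff (2 * j) t :=
      mul_pos (by norm_num) (lt_of_le_of_ne (hnn _) ih.symm)
    exact (add_pos_of_pos_of_nonneg hlt (hsum _)).ne h

/-- At k = 0 the quadratic term drops out (y = sin², y'' = 2 - 4y), so each later even coefficient
is a nonzero multiple of the preceding one. -/
theorem coeff_snSqSeries_zero_ne_zero {j : ℕ} (hj : 1 ≤ j) :
    coeff (2 * j) (snSqSeries 0) ≠ 0 := by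
  have hy := isSnSq_snSqSeries 0
  induction j, hj using Nat.le_induction with
  | base => simp [hy.coeff_two]
  | succ j hj ih =>
    intro hz
    have h := hy.coeff_succ_succ (2 * j)
    rw [show 2 * (j + 1) = 2 * j + 2 by ring] at hz
    rw [hz, if_neg (by omega)] at h
    simp [ih] at h

/-- At k = 0, nc² - 1 = 1/cos² - 1 = tan². -/
theorem e_zero_ne_zero {j : ℕ} (hj : 1 ≤ j) : e j 0 ≠ 0 := by
  have hy := isSnSq_snSqSeries 0
  have hN := taylorSeries_ncSq_mul 0
  have h1 := hy.2.2
  have h2 := hy.second_order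
  have h0 := hy.constantCoeff_eq
  have hc1 := hy.coeff_one
  rw [e_eq_coeff]
  set y := snSqSeries 0
  set N := taylorSeries (ncSq 0)
  simp only [ne_eq, OfNat.ofNat_ne_zero, not_false_eq_true, zero_pow, map_zero, zero_mul,
    sub_zero, mul_one, add_zero, mul_zero, map_one, one_mul] at h1 h2 ⊢
  have hDN : d⁄dX ℂ N = N ^ 2 * d⁄dX ℂ y := by
    have h := congrArg (d⁄dX ℂ) hN
    simp only [Derivation.leibniz, map_sub, derivative_one, smul_eq_mul] at h
    linear_combination N * h - d⁄dX ℂ N * hN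
  have hNc : constantCoeff N = 1 := by
    have h := congrArg constantCoeff hN
    simpa [h0] using h
  apply coeff_ne_zero_of_tan_sq_ode _ _ _ hj
  · simp [hNc]
  · have h := congrArg (coeff 0) hDN
    rw [coeff_derivative] at h
    have h3 : constantCoeff (d⁄dX ℂ y) = 0 := by
      rw [← coeff_zero_eq_constantCoeff_apply, coeff_derivative]
      simp [hc1]
    simp [h3] at h
    simp [h, PowerSeries.coeff_one]
  · rw [map_sub, derivative_one, sub_zero, hDN, Derivation.leibniz, Derivation.leibniz_pow, hDN,
      h2]
    simp only [smul_eq_mul, nsmul_eq_mul]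
    push_cast
    linear_combination 2 * N ^ 3 * h1 + (8 * N ^ 2 * y - 4 * N) * hN

/-- At k = 1, sn = tanh, and -tanh²(iz) = tan² z: rescaling by i reduces the claim to the
coefficients of tan². -/
theorem f_one_ne_zero {j : ℕ} (hj : 1 ≤ j) : f j 1 ≠ 0 := by
  have hy := isSnSq_snSqSeries 1
  have h2 := hy.second_order
  have hc1 := hy.coeff_one
  have h0 := hy.1
  rw [f_eq_coeff]
  set y := snSqSeries 1
  simp only [one_pow, map_one, one_mul] at h2 ⊢
  have hI : (C Complex.I : ℂ⟦X⟧) * C Complex.I = -1 := by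
    rw [← map_mul, Complex.I_mul_I, map_neg, map_one]
  have h := coeff_ne_zero_of_tan_sq_ode (t := -rescale Complex.I y)
    (by rw [map_neg, coeff_rescale, h0]; simp) (by rw [map_neg, coeff_rescale, hc1]; simp)
    (by
      rw [map_neg, map_neg, derivative_rescale, Derivation.leibniz, derivative_C,
        derivative_rescale, h2]
      simp only [map_add, map_sub, map_mul, map_pow, map_ofNat, map_one, smul_eq_mul, mul_zero]
      linear_combination -(2 - 8 * rescale Complex.I y + 6 * rescale Complex.I y ^ 2) * hI) hj
  intro hz
  apply h
  rw [map_neg, neg_eq_zero] at hz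
  rw [map_neg, coeff_rescale, hz, mul_zero, neg_zero]

/-- `d_j`, `e_j` and `f_j` are linearly independent over `ℚ`. -/
theorem eq_zero_of_combination_eq_zero {j : ℕ} (hj : 1 ≤ j) {a b c : ℚ}
    (h : ∀ k, (a : ℂ) * d j k + b * e j k + c * f j k = 0) : a = 0 ∧ b = 0 ∧ c = 0 := by
  obtain ⟨P, hP, hP0⟩ := exists_polynomial_d j
  have hf0 : f j 0 = 0 := by simp [f_eq_coeff]
  have he1 : e j 1 = 0 := by simp [e_eq_coeff]
  have hd0 : d j 0 = 0 := by simp [hP, evalSq_X]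
  have hd1 : d j 1 = 0 := by simp [hP, evalSq_X]
  have hb : b = 0 := by
    have := h 0
    simpa [hf0, hd0, e_zero_ne_zero hj] using this
  have hc : c = 0 := by
    have := h 1
    simpa [he1, hd1, f_one_ne_zero hj] using this
  refine ⟨?_, hb, hc⟩
  -- Evaluation at k = 0 and k = 1 cannot detect d_j, which vanishes at both; its cofactor P is
  -- evaluated at 0 instead.
  by_contra ha
  have hz : Polynomial.X * (1 - Polynomial.X) * P = 0 := by
    refine eq_zero_of_evalSq_eq_zero fun k => ?_
    have := h k
    simpa [hb, hc, ha, ← hP] using this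
  have h1 : (1 - Polynomial.X : Polynomial ℚ) ≠ 0 := by
    intro h1
    have := congrArg (Polynomial.eval 0) h1
    simp at this
  have hP' : P = 0 :=
    (mul_eq_zero.1 hz).resolve_left (mul_ne_zero Polynomial.X_ne_zero h1)
  rw [hP', map_zero] at hP0
  exact coeff_snSqSeries_zero_ne_zero hj hP0.symm

/-! ### The relation module -/

theorem mem_S_iff {j : ℕ} {t : Fin 4 → ℚ} : t ∈ S j ↔ ∀ k : ℂ,
    -(t 0 : ℂ) * thetaMinus j k + t 1 * thetaPlus j k - t 2 * lambdaMinus j k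
      + t 3 * lambdaPlus j k = 0 := by
  change (∑ i, t i • auxVec j i = 0) ↔ _
  rw [funext_iff]
  refine forall_congr' fun k => ?_
  simp only [Fin.sum_univ_four, Pi.add_apply, Pi.smul_apply, auxVec, Rat.smul_def, Pi.zero_apply,
    Matrix.cons_val]
  ring_nf

/-- The coefficient of c_j is (2^(2j+1) - 1) + 2^(2j+1) = 2^(2j+2) - 1 and that of d_j is 1, so this
is `coeff_relation` regrouped. -/
theorem theta_lambda_relation (j : ℕ) (k : ℂ) :
    -(1 - 2 ^ (2 * j + 1)) * thetaMinus j k + 2 ^ (2 * j + 1) * thetaPlus j k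
      - lambdaMinus j k = 0 := by
  have h := coeff_relation j k
  rw [thetaMinus, thetaPlus, lambdaMinus]
  linear_combination h

theorem v_mem_S (j : ℕ) : v j ∈ S j := by
  rw [mem_S_iff]
  intro k
  have h := theta_lambda_relation j k
  simp only [v, Matrix.cons_val]
  push_cast
  linear_combination h

theorem S_eq_span {j : ℕ} (hj : 1 ≤ j) : S j = Submodule.span ℚ {v j} := by
  apply le_antisymm
  · intro t ht
    rw [mem_S_iff] at ht
    -- Eliminate c_j, whose coefficient in the given relation is t₁ - t₀ (indices from 0), using the
    -- duplication relation; a, b, c are the resulting coefficients of d_j, e_j, f_j.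
    have hc := eq_zero_of_combination_eq_zero hj
      (a := (2 ^ (2 * j + 2) - 1) * (t 0 + t 1) - (t 1 - t 0))
      (b := (2 ^ (2 * j + 2) - 1) * (t 3 - t 2) + (t 1 - t 0))
      (c := (2 ^ (2 * j + 2) - 1) * (t 2 + t 3) - (t 1 - t 0)) (fun k => by
        have h1 := ht k
        have h2 := coeff_relation j k
        rw [thetaMinus, thetaPlus, lambdaMinus, lambdaPlus] at h1
        push_cast
        linear_combination (2 ^ (2 * j + 2) - 1) * h1 - (t 1 - t 0) * h2)
    obtain ⟨ha, hb, hc⟩ := hc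
    have hN : (2 ^ (2 * j + 2) - 1 : ℚ) ≠ 0 := by
      rw [sub_ne_zero]
      exact_mod_cast (Nat.one_lt_two_pow (by omega : 2 * j + 2 ≠ 0)).ne'
    have h3 : t 3 = 0 := by
      apply mul_left_cancel₀ hN
      linear_combination (hb + hc) / 2
    have hs : t 0 + t 1 = t 2 := by
      apply mul_left_cancel₀ hN
      linear_combination ha - hc + (2 ^ (2 * j + 2) - 1) * h3
    rw [Submodule.mem_span_singleton]
    refine ⟨t 2, ?_⟩
    ext i
    fin_cases i
    · simp [v]
      linear_combination -(hc / 2) - hs / 2 + (2 ^ (2 * j + 2) - 1) / 2 * h3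
    · simp [v]
      linear_combination hc / 2 - hs / 2 - (2 ^ (2 * j + 2) - 1) / 2 * h3
    · simp [v]
    · simp [v, h3]
  · rw [Submodule.span_singleton_le_iff_mem]
    exact v_mem_S j

theorem finrank_S {j : ℕ} (hj : 1 ≤ j) : Module.finrank ℚ (S j) = 1 := by
  rw [S_eq_span hj]
  apply finrank_span_singleton
  intro h
  have := congrFun h 2
  simp [v] at this

theorem exists_polynomial_auxVec (j : ℕ) (i : Fin 4) :
    ∃ P : Polynomial ℚ, ∀ k : ℂ, auxVec j i k = Polynomial.aeval (k ^ 2) P := by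
  obtain ⟨Pc, hc⟩ := exists_polynomial_c j
  obtain ⟨Pd, hd, -⟩ := exists_polynomial_d j
  obtain ⟨Pe, he⟩ := exists_polynomial_e j
  obtain ⟨Pf, hf⟩ := exists_polynomial_f j
  set Pd' := Polynomial.X * (1 - Polynomial.X) * Pd
  refine ⟨![-(Pc - Pd'), Pc + Pd', -(Pe - Pf), Pe + Pf] i, fun k => ?_⟩
  rw [← evalSq_apply]
  fin_cases i <;> simp [auxVec, thetaMinus, thetaPlus, lambdaMinus, lambdaPlus, hc, hd, he, hf]

/-! ### The quantities `x_n` -/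

theorem x_eq_xBlock (k : ℂ) (j : ℕ) (hj : 1 ≤ j) (i : Fin 4) {n : ℕ}
    (hn : n = 4 * (j - 1) + i + 1) : x k n = xBlock k j i := by
  subst hn
  have hi := i.isLt
  have h1 : (4 * (j - 1) + (i : ℕ) + 1 - 1) / 4 + 1 = j := by omega
  have h2 : Fin.ofNat 4 (4 * (j - 1) + (i : ℕ) + 1 - 1) = i := by
    ext
    simp only [Fin.val_ofNat]
    omega
  rw [x, h1, h2]

theorem not_linearIndependent_of_relation {a b c : ℂ} {p q : ℚ} (h : p * a + q * b - c = 0) :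
    ¬ LinearIndependent ℚ ![a, b, c] := by
  intro hli
  rw [Fintype.linearIndependent_iff] at hli
  have := hli ![p, q, -1] (by
    simp only [Fin.sum_univ_three, Matrix.cons_val, Rat.smul_def]
    push_cast
    linear_combination h) 2
  simp at this

theorem not_linearIndependent_x_even (k : ℂ) {j : ℕ} (hj : 2 ≤ j) (hej : Even j) :
    ¬ LinearIndependent ℚ ![x k (4 * j - 3), x k (4 * j - 2), x k (4 * j - 1)] := by
  rw [x_eq_xBlock k j (by omega) 0 (by simp; omega), x_eq_xBlock k j (by omega) 1 (by simp; omega),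
    x_eq_xBlock k j (by omega) 2 (by simp; omega)]
  apply not_linearIndependent_of_relation (p := -(1 - 2 ^ (2 * (j - 1) + 1)))
    (q := 2 ^ (2 * (j - 1) + 1))
  have h := theta_lambda_relation (j - 1) k
  simp only [xBlock, if_neg (by omega : ¬ j = 1), if_pos hej, Matrix.cons_val]
  push_cast
  linear_combination (2 * K k / Real.pi) ^ (2 * j) * h

theorem not_linearIndependent_x_odd (k : ℂ) {j : ℕ} (hj : 3 ≤ j) (hoj : Odd j) :
    ¬ LinearIndependent ℚ ![x k (4 * j - 3), x k (4 * j - 2), x k (4 * j)] := by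
  rw [x_eq_xBlock k j (by omega) 0 (by simp; omega), x_eq_xBlock k j (by omega) 1 (by simp; omega),
    x_eq_xBlock k j (by omega) 3 (by simp; omega)]
  -- For odd j the signs in the block are interchanged: Θ⁺ precedes Θ⁻, so the two weights swap, and
  -- Λ⁻ is the fourth entry.
  apply not_linearIndependent_of_relation (p := 2 ^ (2 * (j - 1) + 1))
    (q := -(1 - 2 ^ (2 * (j - 1) + 1)))
  have h := theta_lambda_relation (j - 1) k
  simp only [xBlock, if_neg (by omega : ¬ j = 1), if_neg (Nat.not_even_iff_odd.2 hoj),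
    Matrix.cons_val]
  push_cast
  linear_combination (2 * K k / Real.pi) ^ (2 * j) * h

end JacobiAux

theorem mainTheorem2 :
    (∀ j : ℕ, 1 ≤ j →
      (∀ i : Fin 4, ∃ P : Polynomial ℚ, ∀ k : ℂ,
        JacobiAux.auxVec j i k = Polynomial.aeval (k ^ 2) P) ∧
      JacobiAux.S j = Submodule.span ℚ {JacobiAux.v j} ∧
      Module.finrank ℚ (JacobiAux.S j) = 1) ∧
    (∀ k : ℂ, k ≠ 0 → k ≠ 1 → k ≠ -1 → ∀ j : ℕ,
      (2 ≤ j → Even j →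
        ¬ LinearIndependent ℚ
          ![JacobiAux.x k (4 * j - 3), JacobiAux.x k (4 * j - 2), JacobiAux.x k (4 * j - 1)]) ∧
      (3 ≤ j → Odd j →
        ¬ LinearIndependent ℚ
          ![JacobiAux.x k (4 * j - 3), JacobiAux.x k (4 * j - 2), JacobiAux.x k (4 * j)])) := by
  refine ⟨fun j hj => ⟨JacobiAux.exists_polynomial_auxVec j, JacobiAux.S_eq_span hj,
    JacobiAux.finrank_S hj⟩, fun k _ _ _ j => ⟨fun hj hej => ?_, fun hj hoj => ?_⟩⟩
  · exact JacobiAux.not_linearIndependent_x_even k hj hej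
  · exact JacobiAux.not_linearIndependent_x_odd k hj hoj
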